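/- Let $\mathbb{Q}_{\mathbb R}$ be the commutative algebra of reduced biquaternions $q=q_0+q_1\mathbf i+q_2\mathbf j+q_3\mathbf k$ ($q_t\in\mathbb R$), with $\mathbf i^2=\mathbf k^2=-1$, $\mathbf j^2=1$, $\mathbf{ij}=\mathbf{ji}=\mathbf k$, $\mathbf{jk}=\mathbf{kj}=\mathbf i$, $\mathbf{ki}=\mathbf{ik}=-\mathbf j$ and $|q|=\sqrt{q_0^2+q_1^2+q_2^2+q_3^2}$. For a matrix $M=M_0+M_1\mathbf i+M_2\mathbf j+M_3\mathbf k$ over $\mathbb{Q}_{\mathbb R}$ ($M_t$ real) let $\|M\|_F=\big(\sum_{s,t}|m_{st}|^2\big)^{1/2}$ and $M_c^R=[M_0^T,M_1^T,M_2^T,M_3^T]^T$. For real matrices, $\|\cdot\|_F$, $\|\cdot\|_2$ and ${}^\dagger$ denote the Frobenius norm, the spectral norm and the Moore–Penrose inverse. Let $A\in\mathbb{Q}_{\mathbb R}^{m\times n}$, $B\in\mathbb{Q}_{\mathbb R}^{m\times d}$, $C\in\mathbb{Q}_{\mathbb R}^{p\times n}$, $D\in\mathbb{Q}_{\mathbb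 R}^{p\times d}$ with $m\ge n+d$, and let $C_c^R$ have full row rank $4p$. Suppose that the problem $$\min_{X\in\mathbb R^{n\times d}}\|AX-B\|_F\quad\text{subject to}\quad CX=D$$ has a unique solution $X_{RL}$, and that $X_{RL}\neq 0$. Put $$P_r=I_n-(C_c^R)^\dagger C_c^R,\qquad \mathcal L_r=\big(I_n-(A_c^RP_r)^\dagger A_c^R\big)(C_c^R)^\dagger,\qquad R_r=B_c^R-A_c^RX_{RL},$$ $$\mathcal K_A^R=\|C_c^R\|_F\|\mathcal L_r\|_2,\qquad \mathcal K_B^R=\|A_c^R\|_F\|(A_c^RP_r)^\dagger\|_2 .$$ Then there are constants $\epsilon_0>0$ and $K$, depending only on $A,B,C,D$, such that for every $0\le\epsilon\le\epsilon_0$ and all perturbations $\Delta A,\Delta B,\Delta C,\Delta D$ (of the sizes of $A,B,C,D$) with $$\|\Delta A\|_F\le\epsilon\|A\|_F,\quad \|\Delta B\|_F\le\epsilon\|B\|_F,\quad \|\Delta C\|_F\le\epsilon\|C\|_F,\quad \|\Delta D\|_F\le\epsilon\|D\|_F,$$ the matrix $(C+\Delta C)_c^R$ has full row rank, the perturbed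 problem $$\min_{X\in\mathbb R^{n\times d}}\|(A+\Delta A)X-(B+\Delta B)\|_F\quad\text{subject to}\quad (C+\Delta C)X=D+\Delta D$$ has a unique solution $\widehat X_{RL}$, and $\Delta X_{RL}=\widehat X_{RL}-X_{RL}$ satisfies $$\frac{\|\Delta X_{RL}\|_F}{\|X_{RL}\|_F}\le\epsilon\left(\mathcal K_A^R\Big(\frac{\|D_c^R\|_F}{\|C_c^R\|_F\|X_{RL}\|_F}+1\Big)+\mathcal K_B^R\Big(\frac{\|B_c^R\|_F}{\|A_c^R\|_F\|X_{RL}\|_F}+1\Big)+(\mathcal K_B^R)^2\Big(\frac{\|C_c^R\|_F}{\|A_c^R\|_F}\|A_c^R\mathcal L_r\|_2+1\Big)\frac{\|R_r\|_F}{\|A_c^R\|_F\|X_{RL}\|_F}\right)+K\epsilon^2 .$$ (A quotient with zero denominator, which occurs only if $p=0$ or $A=0$, is read as $0$.) -/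

import Mathlib

open scoped Matrix

/-- Reduced biquaternions `re + imI i + imJ j + imK k` with real components. -/
@[ext]
structure RBQ where
  re : ℝ
  imI : ℝ
  imJ : ℝ
  imK : ℝ

namespace RBQ

instance : Zero RBQ := ⟨⟨0, 0, 0, 0⟩⟩

instance : One RBQ := ⟨⟨1, 0, 0, 0⟩⟩

instance : Add RBQ := ⟨fun a b => ⟨a.re + b.re, a.imI + b.imI, a.imJ + b.imJ, a.imK + b.imK⟩⟩

instance : Neg RBQ := ⟨fun a => ⟨-a.re, -a.imI, -a.imJ, -a.imK⟩⟩

instance : Sub RBQ := ⟨fun a b => ⟨a.re - b.re, a.imI - b.imI, a.imJ - b.imJ, a.imK - b.imK⟩⟩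

/-- The multiplication determined by `i² = k² = -1`, `j² = 1`, `ij = ji = k`, `jk = kj = i`,
`ki = ik = -j`. -/
instance : Mul RBQ := ⟨fun a b =>
  ⟨a.re * b.re - a.imI * b.imI + a.imJ * b.imJ - a.imK * b.imK,
   a.re * b.imI + a.imI * b.re + a.imJ * b.imK + a.imK * b.imJ,
   a.re * b.imJ + a.imJ * b.re - a.imI * b.imK - a.imK * b.imI,
   a.re * b.imK + a.imK * b.re + a.imI * b.imJ + a.imJ * b.imI⟩⟩

@[simp] theorem zero_re : (0 : RBQ).re = 0 := rfl
@[simp] theorem zero_imI : (0 : RBQ).imI = 0 := rfl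
@[simp] theorem zero_imJ : (0 : RBQ).imJ = 0 := rfl
@[simp] theorem zero_imK : (0 : RBQ).imK = 0 := rfl
@[simp] theorem one_re : (1 : RBQ).re = 1 := rfl
@[simp] theorem one_imI : (1 : RBQ).imI = 0 := rfl
@[simp] theorem one_imJ : (1 : RBQ).imJ = 0 := rfl
@[simp] theorem one_imK : (1 : RBQ).imK = 0 := rfl
@[simp] theorem add_re (a b : RBQ) : (a + b).re = a.re + b.re := rfl
@[simp] theorem add_imI (a b : RBQ) : (a + b).imI = a.imI + b.imI := rfl
@[simp] theorem add_imJ (a b : RBQ) : (a + b).imJ = a.imJ + b.imJ := rfl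
@[simp] theorem add_imK (a b : RBQ) : (a + b).imK = a.imK + b.imK := rfl
@[simp] theorem neg_re (a : RBQ) : (-a).re = -a.re := rfl
@[simp] theorem neg_imI (a : RBQ) : (-a).imI = -a.imI := rfl
@[simp] theorem neg_imJ (a : RBQ) : (-a).imJ = -a.imJ := rfl
@[simp] theorem neg_imK (a : RBQ) : (-a).imK = -a.imK := rfl
@[simp] theorem sub_re (a b : RBQ) : (a - b).re = a.re - b.re := rfl
@[simp] theorem sub_imI (a b : RBQ) : (a - b).imI = a.imI - b.imI := rfl
@[simp] theorem sub_imJ (a b : RBQ) : (a - b).imJ = a.imJ - b.imJ := rfl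
@[simp] theorem sub_imK (a b : RBQ) : (a - b).imK = a.imK - b.imK := rfl
@[simp] theorem mul_re (a b : RBQ) :
    (a * b).re = a.re * b.re - a.imI * b.imI + a.imJ * b.imJ - a.imK * b.imK := rfl
@[simp] theorem mul_imI (a b : RBQ) :
    (a * b).imI = a.re * b.imI + a.imI * b.re + a.imJ * b.imK + a.imK * b.imJ := rfl
@[simp] theorem mul_imJ (a b : RBQ) :
    (a * b).imJ = a.re * b.imJ + a.imJ * b.re - a.imI * b.imK - a.imK * b.imI := rfl
@[simp] theorem mul_imK (a b : RBQ) :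
    (a * b).imK = a.re * b.imK + a.imK * b.re + a.imI * b.imJ + a.imJ * b.imI := rfl

instance : CommRing RBQ where
  add_assoc a b c := by ext <;> simp <;> ring
  zero_add a := by ext <;> simp
  add_zero a := by ext <;> simp
  add_comm a b := by ext <;> simp <;> ring
  neg_add_cancel a := by ext <;> simp
  sub_eq_add_neg a b := by ext <;> simp <;> ring
  mul_assoc a b c := by ext <;> simp <;> ring
  one_mul a := by ext <;> simp
  mul_one a := by ext <;> simp
  zero_mul a := by ext <;> simp
  mul_zero a := by ext <;> simp
  left_distrib a b c := by ext <;> simp <;> ring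
  right_distrib a b c := by ext <;> simp <;> ring
  mul_comm a b := by ext <;> simp <;> ring
  nsmul := nsmulRec
  zsmul := zsmulRec

/-- The embedding of the real numbers. -/
def ofReal (x : ℝ) : RBQ := ⟨x, 0, 0, 0⟩

/-- The norm of a reduced biquaternion: the Euclidean norm of its four components. -/
noncomputable def abs (a : RBQ) : ℝ := √(a.re ^ 2 + a.imI ^ 2 + a.imJ ^ 2 + a.imK ^ 2)

end RBQ

namespace RBLSE

/-- Frobenius norm of a real matrix. -/
noncomputable def frobR {ι κ : Type*} [Fintype ι] [Fintype κ] (M : Matrix ι κ ℝ) : ℝ :=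
  √(∑ i, ∑ j, M i j ^ 2)

/-- Frobenius norm of a reduced biquaternion matrix. -/
noncomputable def frobQ {ι κ : Type*} [Fintype ι] [Fintype κ] (M : Matrix ι κ RBQ) : ℝ :=
  √(∑ i, ∑ j, (M i j).abs ^ 2)

/-- The 2-norm of a real matrix: its operator norm between Euclidean spaces. -/
noncomputable def norm2 {ι κ : Type*} [Fintype ι] [Fintype κ] [DecidableEq κ]
    (M : Matrix ι κ ℝ) : ℝ :=
  ‖(Matrix.toEuclideanLin M).toContinuousLinearMap‖

/-- A real matrix viewed as a reduced biquaternion matrix. -/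
def toRBQ {ι κ : Type*} (X : Matrix ι κ ℝ) : Matrix ι κ RBQ := X.map RBQ.ofReal

/-- The first block column `[M₀; M₁; M₂; M₃]` of the real representation of
`M = M₀ + M₁ i + M₂ j + M₃ k`. -/
def realCol {ι κ : Type*} (M : Matrix ι κ RBQ) : Matrix ((ι ⊕ ι) ⊕ (ι ⊕ ι)) κ ℝ :=
  Matrix.fromRows (Matrix.fromRows (M.map RBQ.re) (M.map RBQ.imI))
    (Matrix.fromRows (M.map RBQ.imJ) (M.map RBQ.imK))

/-- The four Penrose equations: `N` is the Moore-Penrose inverse of `M`. -/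
structure IsMoorePenrose {ι κ : Type*} [Fintype ι] [Fintype κ]
    (M : Matrix ι κ ℝ) (N : Matrix κ ι ℝ) : Prop where
  mul_mul_self : M * N * M = M
  self_mul_mul : N * M * N = N
  symm_left : (M * N)ᵀ = M * N
  symm_right : (N * M)ᵀ = N * M

theorem exists_isMoorePenrose {ι κ : Type*} [Fintype ι] [Fintype κ]
    (M : Matrix ι κ ℝ) : ∃ N, IsMoorePenrose M N := by
  classical
  have hH : (Mᵀ * M).IsHermitian := by
    simp [Matrix.IsHermitian, Matrix.conjTranspose_eq_transpose_of_trivial, Matrix.transpose_mul]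
  obtain ⟨U, hU, e, he⟩ : ∃ U : Matrix κ κ ℝ, Uᵀ * U = 1 ∧ ∃ e : κ → ℝ,
      Mᵀ * M = U * Matrix.diagonal e * Uᵀ := by
    refine ⟨hH.eigenvectorUnitary, ?_, hH.eigenvalues, ?_⟩
    · have := Unitary.coe_star_mul_self hH.eigenvectorUnitary
      simpa [Matrix.star_eq_conjTranspose, Matrix.conjTranspose_eq_transpose_of_trivial] using this
    · have := hH.spectral_theorem
      simpa [Unitary.conjStarAlgAut_apply, Matrix.star_eq_conjTranspose,
        Matrix.conjTranspose_eq_transpose_of_trivial, Function.comp_def] using this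
  have key : ∀ f g : κ → ℝ, (U * Matrix.diagonal f * Uᵀ) * (U * Matrix.diagonal g * Uᵀ)
      = U * Matrix.diagonal (fun i => f i * g i) * Uᵀ := by
    intro f g
    rw [← Matrix.diagonal_mul_diagonal]
    calc _ = U * Matrix.diagonal f * (Uᵀ * U) * Matrix.diagonal g * Uᵀ := by
          simp only [Matrix.mul_assoc]
      _ = _ := by rw [hU]; simp only [Matrix.mul_one, Matrix.mul_assoc]
  have symm : ∀ f : κ → ℝ,
      (U * Matrix.diagonal f * Uᵀ)ᵀ = U * Matrix.diagonal f * Uᵀ := by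
    intro f
    simp [Matrix.transpose_mul, Matrix.mul_assoc]
  obtain ⟨G, hG⟩ : ∃ G, G = U * Matrix.diagonal (fun i => (e i)⁻¹) * Uᵀ := ⟨_, rfl⟩
  have hGs : Gᵀ = G := by rw [hG, symm]
  have hGHs : (G * (Mᵀ * M))ᵀ = G * (Mᵀ * M) := by rw [hG, he, key, symm]
  have hGHG : G * (Mᵀ * M) * G = G := by
    rw [hG, he, key, key]
    congr 3
    funext i
    by_cases h : e i = 0 <;> simp [h]
  have hHGH : (Mᵀ * M) * (G * (Mᵀ * M)) = Mᵀ * M := by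
    rw [hG, he, key, key]
    congr 3
    funext i
    by_cases h : e i = 0 <;> simp [h]
  have hMGH : M * (G * (Mᵀ * M)) = M := by
    rw [← sub_eq_zero, ← Matrix.conjTranspose_mul_self_eq_zero,
      Matrix.conjTranspose_eq_transpose_of_trivial]
    have h0 : Mᵀ * (M * (G * (Mᵀ * M)) - M) = 0 := by
      rw [Matrix.mul_sub, ← Matrix.mul_assoc, hHGH, sub_self]
    rw [Matrix.transpose_sub, Matrix.transpose_mul, Matrix.sub_mul, Matrix.mul_assoc, h0]
    simp
  refine ⟨G * Mᵀ, ?_, ?_, ?_, ?_⟩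
  · simpa only [Matrix.mul_assoc] using hMGH
  · calc G * Mᵀ * M * (G * Mᵀ) = G * (Mᵀ * M) * G * Mᵀ := by simp only [Matrix.mul_assoc]
      _ = _ := by rw [hGHG]
  · simp [Matrix.transpose_mul, hGs, Matrix.mul_assoc]
  · simpa only [Matrix.mul_assoc] using hGHs

theorem IsMoorePenrose.unique {ι κ : Type*} [Fintype ι] [Fintype κ]
    {M : Matrix ι κ ℝ} {N N' : Matrix κ ι ℝ}
    (h : IsMoorePenrose M N) (h' : IsMoorePenrose M N') : N = N' := by
  have e1 : M * N = M * N' := by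
    calc M * N = (M * N') * (M * N) := by
          rw [← Matrix.mul_assoc, h'.mul_mul_self]
      _ = (M * N')ᵀ * (M * N)ᵀ := by rw [h.symm_left, h'.symm_left]
      _ = ((M * N * M) * N')ᵀ := by rw [← Matrix.transpose_mul]; simp only [Matrix.mul_assoc]
      _ = M * N' := by rw [h.mul_mul_self, h'.symm_left]
  have e2 : N * M = N' * M := by
    calc N * M = (N * M) * (N' * M) := by
          rw [Matrix.mul_assoc, ← Matrix.mul_assoc M, h'.mul_mul_self]
      _ = (N * M)ᵀ * (N' * M)ᵀ := by rw [h.symm_right, h'.symm_right]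
      _ = (N' * (M * N * M))ᵀ := by rw [← Matrix.transpose_mul]; simp only [Matrix.mul_assoc]
      _ = N' * M := by rw [h.mul_mul_self, h'.symm_right]
  calc N = N * M * N := h.self_mul_mul.symm
    _ = N' * M * N' := by rw [e2, Matrix.mul_assoc, e1, Matrix.mul_assoc]
    _ = N' := h'.self_mul_mul

/-- The Moore-Penrose inverse of a real matrix. -/
noncomputable def pinv {ι κ : Type*} [Fintype ι] [Fintype κ] (M : Matrix ι κ ℝ) : Matrix κ ι ℝ :=
  Classical.choose (exists_isMoorePenrose M)

theorem pinv_spec {ι κ : Type*} [Fintype ι] [Fintype κ] (M : Matrix ι κ ℝ) :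
    IsMoorePenrose M (pinv M) :=
  Classical.choose_spec (exists_isMoorePenrose M)

section Problem

variable {m n d p : ℕ}

/-- `X` is a real solution of the equality constrained least squares problem
`min ‖A X - B‖_F` subject to `C X = D`, the minimum being over all real `n × d` matrices. -/
def IsRealSolution (A : Matrix (Fin m) (Fin n) RBQ) (B : Matrix (Fin m) (Fin d) RBQ)
    (C : Matrix (Fin p) (Fin n) RBQ) (D : Matrix (Fin p) (Fin d) RBQ)
    (X : Matrix (Fin n) (Fin d) ℝ) : Prop :=
  C * toRBQ X = D ∧
    ∀ Y : Matrix (Fin n) (Fin d) ℝ, C * toRBQ Y = D →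
      frobQ (A * toRBQ X - B) ≤ frobQ (A * toRBQ Y - B)

/-- `P_r = I - (C_c)† C_c`. -/
noncomputable def Pr (C : Matrix (Fin p) (Fin n) RBQ) : Matrix (Fin n) (Fin n) ℝ :=
  1 - pinv (realCol C) * realCol C

/-- `L_r = (I - (A_c P_r)† A_c) (C_c)†`. -/
noncomputable def Lr (A : Matrix (Fin m) (Fin n) RBQ) (C : Matrix (Fin p) (Fin n) RBQ) :
    Matrix (Fin n) ((Fin p ⊕ Fin p) ⊕ (Fin p ⊕ Fin p)) ℝ :=
  (1 - pinv (realCol A * Pr C) * realCol A) * pinv (realCol C)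

/-- `K_A = ‖C_c‖_F ‖L_r‖₂`. -/
noncomputable def condA (A : Matrix (Fin m) (Fin n) RBQ) (C : Matrix (Fin p) (Fin n) RBQ) : ℝ :=
  frobR (realCol C) * norm2 (Lr A C)

/-- `K_B = ‖A_c‖_F ‖(A_c P_r)†‖₂`. -/
noncomputable def condB (A : Matrix (Fin m) (Fin n) RBQ) (C : Matrix (Fin p) (Fin n) RBQ) : ℝ :=
  frobR (realCol A) * norm2 (pinv (realCol A * Pr C))

/-- The residual `R_r = B_c - A_c X`. -/
def resid (A : Matrix (Fin m) (Fin n) RBQ) (B : Matrix (Fin m) (Fin d) RBQ)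
    (X : Matrix (Fin n) (Fin d) ℝ) :
    Matrix ((Fin m ⊕ Fin m) ⊕ (Fin m ⊕ Fin m)) (Fin d) ℝ :=
  realCol B - realCol A * X

end Problem

end RBLSE

/-! For real `X`, the columns of `M * toRBQ X` are real combinations of those of `M`, so the
additive, injective, Frobenius-isometric map `realCol` turns the problem into min ‖aX - b‖ subject
to cX = d over the reals. Its solutions are governed by the linear KKT system aᵀaX + cᵀl = aᵀb, cX =
d. Full row rank of c together with uniqueness makes `kktMatrix a c` invertible, and invertibility
survives small perturbations; this gives the rank, existence and uniqueness claims.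

For the estimate, put Q = (aP)† with P = 1 - c†c, and L = (1 - Qa)c†. The identities QQᵀaᵀ = Q, cQ =
0, Qa + Lc = 1 and cL = 1 show that the upper block row of the inverse KKT matrix is [QQᵀ, L], and
that l = (aL)ᵀR with R = b - aX. Subtracting the two KKT systems, the first-order part of the error
is QQᵀ(ΔaᵀR - Δcᵀl) + Q(Δb - ΔaX) + L(Δd - ΔcX). Its termwise bound is exactly the stated
coefficient (`norm_first_order_le`, `firstOrderBound_div_eq`); everything else is a product of two
O(ε) factors (`exists_perturbation_bound`). -/

namespace RBLSE

/-! ### Frobenius and spectral norm estimates; stability of left inverses. -/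

section Norms

variable {ι κ μ : Type*} [Fintype ι] [Fintype κ] [Fintype μ]

theorem frobR_nonneg (M : Matrix ι κ ℝ) : 0 ≤ frobR M := Real.sqrt_nonneg _

theorem frobR_sq (M : Matrix ι κ ℝ) : frobR M ^ 2 = ∑ i, ∑ j, M i j ^ 2 :=
  Real.sq_sqrt (by positivity)

theorem norm2_nonneg [DecidableEq κ] (M : Matrix ι κ ℝ) : 0 ≤ norm2 M := norm_nonneg _

theorem sum_sq_mulVec_le [DecidableEq κ] (M : Matrix ι κ ℝ) (v : κ → ℝ) :
    ∑ i, (M *ᵥ v) i ^ 2 ≤ norm2 M ^ 2 * ∑ k, v k ^ 2 := by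
  have h := (Matrix.toEuclideanLin M).toContinuousLinearMap.le_opNorm (WithLp.toLp 2 v)
  have h2 := pow_le_pow_left₀ (norm_nonneg _) h 2
  rw [mul_pow, EuclideanSpace.norm_sq_eq, EuclideanSpace.norm_sq_eq] at h2
  simpa [norm2, sq_abs, Matrix.toLpLin_apply] using h2

theorem frobR_mul_le_norm2_mul [DecidableEq κ] (M : Matrix ι κ ℝ) (N : Matrix κ μ ℝ) :
    frobR (M * N) ≤ norm2 M * frobR N := by
  refine le_of_sq_le_sq ?_ (mul_nonneg (norm2_nonneg M) (frobR_nonneg N))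
  rw [mul_pow, frobR_sq, frobR_sq, Finset.sum_comm, Finset.sum_comm (s := Finset.univ (α := κ)),
    Finset.mul_sum]
  exact Finset.sum_le_sum fun j _ => sum_sq_mulVec_le M fun k => N k j

open scoped Matrix.Norms.L2Operator in
theorem norm2_transpose [DecidableEq ι] [DecidableEq κ] (M : Matrix ι κ ℝ) :
    norm2 Mᵀ = norm2 M := by
  have h := Matrix.l2_opNorm_conjTranspose M
  rwa [Matrix.conjTranspose_eq_transpose_of_trivial] at h

attribute [local instance] Matrix.frobeniusNormedAddCommGroup

theorem frobR_eq_norm (M : Matrix ι κ ℝ) : frobR M = ‖M‖ := by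
  simp [frobR, Matrix.frobenius_norm_def, Real.sqrt_eq_rpow]

theorem norm_transpose_mul_le (M : Matrix κ ι ℝ) (N : Matrix κ μ ℝ) :
    ‖Mᵀ * N‖ ≤ ‖M‖ * ‖N‖ := by
  simpa only [Matrix.frobenius_norm_transpose] using Matrix.frobenius_norm_mul Mᵀ N

theorem norm_mul_le_norm2_mul [DecidableEq κ] (M : Matrix ι κ ℝ) (N : Matrix κ μ ℝ) :
    ‖M * N‖ ≤ norm2 M * ‖N‖ := by
  simpa only [frobR_eq_norm] using frobR_mul_le_norm2_mul M N

theorem norm_sq_eq_trace (M : Matrix ι κ ℝ) : ‖M‖ ^ 2 = (Mᵀ * M).trace := by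
  rw [← frobR_eq_norm, frobR_sq, Finset.sum_comm]
  simp [Matrix.trace, Matrix.mul_apply, sq]

theorem norm_fromRows_sq {ι₁ ι₂ : Type*} [Fintype ι₁] [Fintype ι₂]
    (M : Matrix ι₁ κ ℝ) (N : Matrix ι₂ κ ℝ) :
    ‖Matrix.fromRows M N‖ ^ 2 = ‖M‖ ^ 2 + ‖N‖ ^ 2 := by
  simp only [← frobR_eq_norm, frobR_sq, Fintype.sum_sum_type, Matrix.fromRows_apply_inl,
    Matrix.fromRows_apply_inr]

theorem norm_fromRows_le {ι₁ ι₂ : Type*} [Fintype ι₁] [Fintype ι₂]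
    (M : Matrix ι₁ κ ℝ) (N : Matrix ι₂ κ ℝ) :
    ‖Matrix.fromRows M N‖ ≤ ‖M‖ + ‖N‖ := by
  refine le_of_sq_le_sq ?_ (by positivity)
  rw [norm_fromRows_sq]
  nlinarith [mul_nonneg (norm_nonneg M) (norm_nonneg N)]

theorem norm_fromCols_le {κ₁ κ₂ : Type*} [Fintype κ₁] [Fintype κ₂]
    (M : Matrix ι κ₁ ℝ) (N : Matrix ι κ₂ ℝ) :
    ‖Matrix.fromCols M N‖ ≤ ‖M‖ + ‖N‖ := by
  rw [← Matrix.frobenius_norm_transpose, Matrix.transpose_fromCols,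
    ← Matrix.frobenius_norm_transpose M, ← Matrix.frobenius_norm_transpose N]
  exact norm_fromRows_le _ _

/-- Since z = G(M + E)z - GEz and the last term is at most ‖z‖/2, it can be absorbed on the left.
This gives both invertibility of M + E and the a priori O(ε) bound on the error. -/
theorem norm_le_two_mul_of_perturbed_system [DecidableEq κ] {M E : Matrix ι κ ℝ}
    {G : Matrix κ ι ℝ} (hG : G * M = 1)
    (hE : ‖G‖ * ‖E‖ ≤ 1 / 2) (z : Matrix κ μ ℝ) : ‖z‖ ≤ 2 * ‖G‖ * ‖(M + E) * z‖ := by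
  have h : z = G * ((M + E) * z) - G * (E * z) := by
    rw [Matrix.add_mul, Matrix.mul_add, ← Matrix.mul_assoc G M, hG, Matrix.one_mul,
      add_sub_cancel_right]
  have h1 : ‖z‖ ≤ ‖G‖ * ‖(M + E) * z‖ + ‖G‖ * (‖E‖ * ‖z‖) := by
    calc ‖z‖ = ‖G * ((M + E) * z) - G * (E * z)‖ := by rw [← h]
      _ ≤ ‖G * ((M + E) * z)‖ + ‖G * (E * z)‖ := norm_sub_le _ _
      _ ≤ ‖G‖ * ‖(M + E) * z‖ + ‖G‖ * ‖E * z‖ := by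
        gcongr <;> exact Matrix.frobenius_norm_mul _ _
      _ ≤ _ := by
        gcongr
        exact Matrix.frobenius_norm_mul _ _
  nlinarith [mul_le_mul_of_nonneg_right hE (norm_nonneg z)]

theorem isUnit_of_mulVec_eq_zero [DecidableEq κ] {M : Matrix κ κ ℝ}
    (h : ∀ v, M *ᵥ v = 0 → v = 0) : IsUnit M := by
  rw [← Matrix.mulVec_injective_iff_isUnit]
  exact (injective_iff_map_eq_zero M.mulVecLin).2 h

theorem isUnit_add_of_norm_le [DecidableEq κ] {M E G : Matrix κ κ ℝ} (hG : G * M = 1)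
    (hE : ‖G‖ * ‖E‖ ≤ 1 / 2) : IsUnit (M + E) := by
  refine isUnit_of_mulVec_eq_zero fun v hv => ?_
  have h0 : (M + E) * Matrix.replicateCol (Fin 1) v = 0 := by
    rw [← Matrix.replicateCol_mulVec]
    ext i
    simpa using congrFun hv i
  have h := norm_le_two_mul_of_perturbed_system hG hE (Matrix.replicateCol (Fin 1) v)
  rw [h0, norm_zero, mul_zero] at h
  have h1 := norm_le_zero_iff.1 h
  ext i
  simpa using congrFun (congrFun h1 i) 0

end Norms

/-! ### Optimality conditions of the real constrained problem. -/

section RealProblem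

variable {ι κ ν δ : Type*} [Fintype ι] [Fintype κ] [Fintype ν] [Fintype δ]

/-- `X` solves the real problem `min ‖a X - b‖_F` subject to `c X = d`. -/
def IsLSESolution (a : Matrix ι ν ℝ) (b : Matrix ι δ ℝ) (c : Matrix κ ν ℝ) (d : Matrix κ δ ℝ)
    (X : Matrix ν δ ℝ) : Prop :=
  c * X = d ∧ ∀ Y : Matrix ν δ ℝ, c * Y = d → frobR (a * X - b) ≤ frobR (a * Y - b)

/-- The matrix of the optimality conditions of the equality constrained least squares problem. -/
def kktMatrix (a : Matrix ι ν ℝ) (c : Matrix κ ν ℝ) : Matrix (ν ⊕ κ) (ν ⊕ κ) ℝ :=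
  Matrix.fromBlocks (aᵀ * a) cᵀ c 0

omit [Fintype δ] in
theorem kktMatrix_mul_fromRows (a : Matrix ι ν ℝ) (c : Matrix κ ν ℝ)
    (X : Matrix ν δ ℝ) (l : Matrix κ δ ℝ) :
    kktMatrix a c * Matrix.fromRows X l = Matrix.fromRows (aᵀ * a * X + cᵀ * l) (c * X) := by
  simp [kktMatrix, Matrix.fromBlocks_mul_fromRows]

omit [Fintype δ] in
theorem eq_zero_of_mul_eq_zero_of_isUnit_kktMatrix [DecidableEq ν] [DecidableEq κ]
    {a : Matrix ι ν ℝ} {c : Matrix κ ν ℝ} (h : IsUnit (kktMatrix a c))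
    {X : Matrix ν δ ℝ} {l : Matrix κ δ ℝ} (h1 : aᵀ * a * X + cᵀ * l = 0) (h2 : c * X = 0) :
    X = 0 ∧ l = 0 := by
  have h3 := kktMatrix_mul_fromRows a c X l
  rw [h1, h2, Matrix.fromRows_zero] at h3
  have h4 : Matrix.fromRows X l = 0 := by
    obtain ⟨u, hu⟩ := h
    rw [← hu] at h3
    have := congrArg (fun z => (↑u⁻¹ : Matrix (ν ⊕ κ) (ν ⊕ κ) ℝ) * z) h3
    simpa [← Matrix.mul_assoc] using this
  rw [← Matrix.fromRows_zero, Matrix.fromRows_inj.eq_iff] at h4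
  exact h4

attribute [local instance] Matrix.frobeniusNormedAddCommGroup

/-- Pythagoras: aᵀ(aX - b) = -cᵀl, while c(Y - X) = 0, so the cross terms vanish. -/
theorem norm_residual_sq_of_kkt {a : Matrix ι ν ℝ} {b : Matrix ι δ ℝ} {c : Matrix κ ν ℝ}
    {X Y : Matrix ν δ ℝ} {l : Matrix κ δ ℝ}
    (h1 : aᵀ * a * X + cᵀ * l = aᵀ * b) (hY : c * Y = c * X) :
    ‖a * Y - b‖ ^ 2 = ‖a * X - b‖ ^ 2 + ‖a * (Y - X)‖ ^ 2 := by
  have e : a * Y - b = (a * X - b) + a * (Y - X) := by rw [Matrix.mul_sub]; abel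
  have h0 : (a * (Y - X))ᵀ * (a * X - b) = 0 := by
    have : aᵀ * (a * X - b) = - (cᵀ * l) := by
      rw [Matrix.mul_sub, ← h1, Matrix.mul_assoc]; abel
    rw [Matrix.transpose_mul, Matrix.mul_assoc, this, Matrix.mul_neg, ← Matrix.mul_assoc,
      ← Matrix.transpose_mul, Matrix.mul_sub, hY]
    simp
  have h0' : (a * X - b)ᵀ * (a * (Y - X)) = 0 := by
    have := congrArg Matrix.transpose h0
    simpa only [Matrix.transpose_mul (_ᵀ), Matrix.transpose_transpose, Matrix.transpose_zero]
      using this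
  rw [e, norm_sq_eq_trace, Matrix.transpose_add, Matrix.add_mul, Matrix.mul_add, Matrix.mul_add,
    h0, h0', norm_sq_eq_trace, norm_sq_eq_trace]
  simp [Matrix.trace_add]

/-- By Pythagoras a KKT point is a minimiser, and any other minimiser differs from it by an element
of ker a ∩ ker c, which is trivial when the KKT matrix is invertible. -/
theorem isLSESolution_iff_eq_of_kkt [DecidableEq ν] [DecidableEq κ] {a : Matrix ι ν ℝ}
    {b : Matrix ι δ ℝ} {c : Matrix κ ν ℝ} {d : Matrix κ δ ℝ} {X : Matrix ν δ ℝ}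
    {l : Matrix κ δ ℝ} (hu : IsUnit (kktMatrix a c))
    (h1 : aᵀ * a * X + cᵀ * l = aᵀ * b) (h2 : c * X = d) (Y : Matrix ν δ ℝ) :
    IsLSESolution a b c d Y ↔ Y = X := by
  simp only [IsLSESolution, frobR_eq_norm]
  constructor
  · rintro ⟨hY, hmin⟩
    have h3 := norm_residual_sq_of_kkt h1 (hY.trans h2.symm)
    have h4 := pow_le_pow_left₀ (norm_nonneg _) (hmin X h2) 2
    have h5 : ‖a * (Y - X)‖ = 0 := by
      rw [← sq_eq_zero_iff]
      exact le_antisymm (by linarith) (sq_nonneg _)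
    rw [norm_eq_zero] at h5
    have h6 := eq_zero_of_mul_eq_zero_of_isUnit_kktMatrix hu (X := Y - X)
      (l := (0 : Matrix κ δ ℝ)) (by rw [Matrix.mul_assoc, h5]; simp)
      (by rw [Matrix.mul_sub, hY, h2, sub_self])
    exact sub_eq_zero.1 h6.1
  · rintro rfl
    refine ⟨h2, fun Z hZ => ?_⟩
    have h3 := norm_residual_sq_of_kkt h1 (hZ.trans h2.symm)
    exact le_of_sq_le_sq (by nlinarith [sq_nonneg ‖a * (Z - Y)‖]) (norm_nonneg _)

omit [Fintype δ] in
theorem exists_kkt_of_isUnit [DecidableEq ν] [DecidableEq κ] {a : Matrix ι ν ℝ}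
    {c : Matrix κ ν ℝ} (hu : IsUnit (kktMatrix a c)) (b : Matrix ι δ ℝ) (d : Matrix κ δ ℝ) :
    ∃ (X : Matrix ν δ ℝ) (l : Matrix κ δ ℝ), aᵀ * a * X + cᵀ * l = aᵀ * b ∧ c * X = d := by
  obtain ⟨u, hu⟩ := hu
  let z : Matrix (ν ⊕ κ) δ ℝ :=
    (↑u⁻¹ : Matrix (ν ⊕ κ) (ν ⊕ κ) ℝ) * Matrix.fromRows (aᵀ * b) d
  refine ⟨z.toRows₁, z.toRows₂, ?_⟩
  have h := kktMatrix_mul_fromRows a c z.toRows₁ z.toRows₂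
  rw [Matrix.fromRows_toRows, ← hu, ← Matrix.mul_assoc, Units.mul_inv, Matrix.one_mul] at h
  obtain ⟨h1, h2⟩ := (Matrix.fromRows_inj.eq_iff).1 h
  exact ⟨h1.symm, h2.symm⟩

theorem rank_eq_card_iff_transpose_mulVec (c : Matrix κ ν ℝ) :
    c.rank = Fintype.card κ ↔ ∀ v : κ → ℝ, cᵀ *ᵥ v = 0 → v = 0 := by
  have h : c.rank = Fintype.card κ ↔ LinearIndependent ℝ c.row := by
    rw [linearIndependent_iff_card_eq_finrank_span, Matrix.rank_eq_finrank_span_row, Set.finrank,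
      eq_comm]
  rw [h, ← Matrix.vecMul_injective_iff]
  simp only [Matrix.mulVec_transpose]
  exact injective_iff_map_eq_zero c.vecMulLinear

theorem isUnit_kktMatrix_of_rank [DecidableEq ν] [DecidableEq κ] {a : Matrix ι ν ℝ}
    {c : Matrix κ ν ℝ} (hc : c.rank = Fintype.card κ)
    (h : ∀ v : ν → ℝ, a *ᵥ v = 0 → c *ᵥ v = 0 → v = 0) : IsUnit (kktMatrix a c) := by
  refine isUnit_of_mulVec_eq_zero fun v hv => ?_
  obtain ⟨x, l, rfl⟩ : ∃ x l, v = Sum.elim x l := ⟨_, _, (Sum.elim_comp_inl_inr v).symm⟩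
  rw [kktMatrix, Matrix.fromBlocks_mulVec] at hv
  have h1 : (aᵀ * a) *ᵥ x + cᵀ *ᵥ l = 0 := by
    ext i; simpa using congrFun hv (Sum.inl i)
  have h2 : c *ᵥ x = 0 := by
    ext i; simpa using congrFun hv (Sum.inr i)
  -- Pairing the first KKT row with x leaves |ax|², because the multiplier term is (cx)·l = 0.
  have h3 : a *ᵥ x = 0 := by
    rw [← dotProduct_self_eq_zero]
    have := congrArg (fun w => x ⬝ᵥ w) h1
    simp only [dotProduct_add, dotProduct_zero, ← Matrix.mulVec_mulVec,
      Matrix.dotProduct_mulVec, Matrix.vecMul_transpose, h2, zero_dotProduct, add_zero] at this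
    rwa [Matrix.dotProduct_mulVec]
  have hx := h x h3 h2
  subst hx
  have hl := (rank_eq_card_iff_transpose_mulVec c).1 hc l (by simpa using h1)
  subst hl
  ext (i | i) <;> simp

theorem rank_eq_card_of_isUnit_kktMatrix [DecidableEq ν] [DecidableEq κ] {a : Matrix ι ν ℝ}
    {c : Matrix κ ν ℝ} (h : IsUnit (kktMatrix a c)) : c.rank = Fintype.card κ := by
  rw [rank_eq_card_iff_transpose_mulVec]
  intro v hv
  have h1 : cᵀ * Matrix.replicateCol (Fin 1) v = 0 := by
    rw [← Matrix.replicateCol_mulVec, hv]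
    rfl
  have h2 := (eq_zero_of_mul_eq_zero_of_isUnit_kktMatrix h (X := (0 : Matrix ν (Fin 1) ℝ))
    (by simpa using h1) (by simp)).2
  ext i
  simpa using congrFun (congrFun h2 i) 0

/-- A nonzero v in ker a ∩ ker c, added to every column of X, would give a second solution; this
needs at least one column. -/
theorem isUnit_kktMatrix_of_unique [DecidableEq ν] [DecidableEq κ] {a : Matrix ι ν ℝ}
    {b : Matrix ι δ ℝ} {c : Matrix κ ν ℝ} {d : Matrix κ δ ℝ} {X : Matrix ν δ ℝ}
    [Nonempty δ] (hc : c.rank = Fintype.card κ) (hX : IsLSESolution a b c d X)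
    (huniq : ∀ Y, IsLSESolution a b c d Y → Y = X) : IsUnit (kktMatrix a c) := by
  refine isUnit_kktMatrix_of_rank hc fun v hav hcv => ?_
  have ha : a * Matrix.replicateCol δ v = 0 := by
    rw [← Matrix.replicateCol_mulVec, hav]; rfl
  have hc' : c * Matrix.replicateCol δ v = 0 := by
    rw [← Matrix.replicateCol_mulVec, hcv]; rfl
  have h := huniq (X + Matrix.replicateCol δ v) (by
    rw [IsLSESolution, Matrix.mul_add, Matrix.mul_add, ha, hc', add_zero, add_zero]
    exact hX)
  rw [add_eq_left] at h
  ext i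
  simpa using congrFun (congrFun h i) (Classical.arbitrary δ)

end RealProblem
-- Identities for Q = (aP)† and L = (1 - Qa)c†.
section ConstrainedPseudoinverse

variable {ι κ ν : Type*} [Fintype ι] [Fintype κ] [Fintype ν] [DecidableEq ν]

omit [DecidableEq ν] in
theorem mul_pinv_of_rank [DecidableEq κ] {c : Matrix κ ν ℝ} (hc : c.rank = Fintype.card κ) :
    c * pinv c = 1 := by
  have h := (pinv_spec c).mul_mul_self
  rw [← sub_eq_zero, ← Matrix.transpose_inj, Matrix.transpose_zero]
  have h0 : cᵀ * (c * pinv c - 1)ᵀ = 0 := by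
    rw [← Matrix.transpose_mul, Matrix.sub_mul, h, Matrix.one_mul, sub_self, Matrix.transpose_zero]
  ext i j
  have := (rank_eq_card_iff_transpose_mulVec c).1 hc (fun k => (c * pinv c - 1)ᵀ k j)
    (by ext k; exact congrFun (congrFun h0 k) j)
  exact congrFun this i

theorem transpose_one_sub_pinv_mul (c : Matrix κ ν ℝ) :
    (1 - pinv c * c)ᵀ = 1 - pinv c * c := by
  rw [Matrix.transpose_sub, (pinv_spec c).symm_right, Matrix.transpose_one]

theorem mul_one_sub_pinv_mul (c : Matrix κ ν ℝ) : c * (1 - pinv c * c) = 0 := by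
  rw [Matrix.mul_sub, ← Matrix.mul_assoc, (pinv_spec c).mul_mul_self, Matrix.mul_one, sub_self]

theorem one_sub_pinv_mul_mul_self (c : Matrix κ ν ℝ) :
    (1 - pinv c * c) * (1 - pinv c * c) = 1 - pinv c * c := by
  rw [Matrix.sub_mul, Matrix.mul_assoc, mul_one_sub_pinv_mul]
  simp

omit [DecidableEq ν] in
-- For M = aP, M† = (M†M)ᵀM† = Paᵀ(M†)ᵀM†, so the range of M† lies in that of P.
theorem projection_mul_pinv {P : Matrix ν ν ℝ} (hPt : Pᵀ = P) (hPP : P * P = P)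
    (a : Matrix ι ν ℝ) : P * pinv (a * P) = pinv (a * P) := by
  have h := pinv_spec (a * P)
  have e : pinv (a * P) = P * (aᵀ * (pinv (a * P))ᵀ * pinv (a * P)) := by
    conv_lhs => rw [← h.self_mul_mul, ← h.symm_right]
    rw [Matrix.transpose_mul, Matrix.transpose_mul, hPt]
    simp only [Matrix.mul_assoc]
  rw [e, ← Matrix.mul_assoc, hPP]

variable (a : Matrix ι ν ℝ) (c : Matrix κ ν ℝ)

theorem mul_pinv_mul_projection : c * pinv (a * (1 - pinv c * c)) = 0 := by
  rw [← projection_mul_pinv (transpose_one_sub_pinv_mul c) (one_sub_pinv_mul_mul_self c),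
    ← Matrix.mul_assoc, mul_one_sub_pinv_mul, Matrix.zero_mul]

theorem mul_pinv_mul_projection_eq :
    a * pinv (a * (1 - pinv c * c))
      = a * (1 - pinv c * c) * pinv (a * (1 - pinv c * c)) := by
  rw [Matrix.mul_assoc a,
    projection_mul_pinv (transpose_one_sub_pinv_mul c) (one_sub_pinv_mul_mul_self c)]

/-- Because Q = PQ, the product aQ = (aP)Q is symmetric, so Q(aQ)ᵀ = Q(aP)Q = Q. -/
theorem pinv_mul_transpose_mul_transpose :
    pinv (a * (1 - pinv c * c)) * (pinv (a * (1 - pinv c * c)))ᵀ * aᵀ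
      = pinv (a * (1 - pinv c * c)) := by
  have h := pinv_spec (a * (1 - pinv c * c))
  rw [Matrix.mul_assoc, ← Matrix.transpose_mul, mul_pinv_mul_projection_eq, h.symm_left,
    ← Matrix.mul_assoc, h.self_mul_mul]

theorem mul_constrained_inverse [DecidableEq κ] (hc : c.rank = Fintype.card κ) :
    c * ((1 - pinv (a * (1 - pinv c * c)) * a) * pinv c) = 1 := by
  rw [← Matrix.mul_assoc, Matrix.mul_sub, ← Matrix.mul_assoc c, mul_pinv_mul_projection,
    Matrix.zero_mul, Matrix.mul_one, sub_zero, mul_pinv_of_rank hc]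

variable {a c}

/-- The matrix (1 - Qa)P is annihilated by both a and c, hence is zero; expanding P = 1 - c†c gives
the claim. -/
theorem pinv_mul_add_constrained_inverse_mul [DecidableEq κ] (hu : IsUnit (kktMatrix a c)) :
    pinv (a * (1 - pinv c * c)) * a
      + (1 - pinv (a * (1 - pinv c * c)) * a) * pinv c * c = 1 := by
  have h := pinv_spec (a * (1 - pinv c * c))
  have hN : (1 - pinv (a * (1 - pinv c * c)) * a) * (1 - pinv c * c) = 0 := by
    refine (eq_zero_of_mul_eq_zero_of_isUnit_kktMatrix hu (l := (0 : Matrix κ ν ℝ)) ?_ ?_).1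
    · have : a * ((1 - pinv (a * (1 - pinv c * c)) * a) * (1 - pinv c * c)) = 0 := by
        rw [Matrix.sub_mul, Matrix.mul_sub, Matrix.mul_assoc _ a, ← Matrix.mul_assoc a (pinv _),
          mul_pinv_mul_projection_eq, h.mul_mul_self, Matrix.one_mul, sub_self]
      rw [Matrix.mul_assoc, this]
      simp
    · rw [← Matrix.mul_assoc, Matrix.mul_sub c 1 (_ * a), ← Matrix.mul_assoc c,
        mul_pinv_mul_projection, Matrix.zero_mul, Matrix.mul_one, sub_zero, mul_one_sub_pinv_mul]
  rw [Matrix.mul_sub, Matrix.mul_one, sub_eq_zero] at hN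
  rw [Matrix.mul_assoc, ← hN]
  abel

end ConstrainedPseudoinverse

/-! ### Exact error equation and its first-order bound. -/

section Perturbation

variable {ι κ ν δ : Type*} [Fintype ι] [Fintype κ] [Fintype ν] [Fintype δ]
  [DecidableEq ι] [DecidableEq κ] [DecidableEq ν]

/-- The change of `kktMatrix a c` when `a` and `c` change by `Δa` and `Δc`. -/
def kktIncrement (a Δa : Matrix ι ν ℝ) (Δc : Matrix κ ν ℝ) : Matrix (ν ⊕ κ) (ν ⊕ κ) ℝ :=
  Matrix.fromBlocks (Δaᵀ * a + aᵀ * Δa + Δaᵀ * Δa) Δcᵀ Δc 0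

omit [Fintype κ] [Fintype ν] [DecidableEq ι] [DecidableEq κ] [DecidableEq ν] in
theorem kktMatrix_add (a Δa : Matrix ι ν ℝ) (c Δc : Matrix κ ν ℝ) :
    kktMatrix (a + Δa) (c + Δc) = kktMatrix a c + kktIncrement a Δa Δc := by
  rw [kktMatrix, kktMatrix, kktIncrement, Matrix.fromBlocks_add, Matrix.transpose_add,
    Matrix.transpose_add, add_zero, Matrix.add_mul, Matrix.mul_add, Matrix.mul_add]
  congr 1
  abel

omit [Fintype δ] [DecidableEq ι] [DecidableEq κ] [DecidableEq ν] in
-- Difference of the two KKT systems, with nothing discarded: the second-order term Δaᵀ(Δb - ΔaX)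
-- stays explicit.
theorem kktMatrix_add_mul_sub {a Δa : Matrix ι ν ℝ} {b Δb : Matrix ι δ ℝ} {c Δc : Matrix κ ν ℝ}
    {d Δd : Matrix κ δ ℝ} {X X' : Matrix ν δ ℝ} {l l' : Matrix κ δ ℝ}
    (h1 : aᵀ * a * X + cᵀ * l = aᵀ * b) (h2 : c * X = d)
    (h1' : (a + Δa)ᵀ * (a + Δa) * X' + (c + Δc)ᵀ * l' = (a + Δa)ᵀ * (b + Δb))
    (h2' : (c + Δc) * X' = d + Δd) :
    (kktMatrix a c + kktIncrement a Δa Δc) * Matrix.fromRows (X' - X) (l' - l) =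
      Matrix.fromRows
        (Δaᵀ * (b - a * X) + aᵀ * (Δb - Δa * X) - Δcᵀ * l + Δaᵀ * (Δb - Δa * X))
        (Δd - Δc * X) := by
  rw [← kktMatrix_add, kktMatrix_mul_fromRows]
  congr 1
  · have e : (a + Δa)ᵀ * (a + Δa) * (X' - X) + (c + Δc)ᵀ * (l' - l)
        = (a + Δa)ᵀ * (b + Δb)
          - ((a + Δa)ᵀ * (a + Δa) * X + (c + Δc)ᵀ * l) - (aᵀ * b - (aᵀ * a * X + cᵀ * l)) := by
      rw [← h1', h1, Matrix.mul_sub, Matrix.mul_sub]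
      abel
    rw [e]
    simp only [Matrix.transpose_add, Matrix.add_mul, Matrix.mul_add, Matrix.mul_sub,
      Matrix.mul_assoc]
    abel
  · rw [Matrix.mul_sub, h2', Matrix.add_mul, h2]
    abel

omit [Fintype δ] [DecidableEq ι] [DecidableEq κ] in
-- The hypotheses say that [S, L] times the KKT matrix is [1, 0], so multiplying the error equation
-- by [S, L] isolates x.
theorem sub_eq_first_order_sub {a Δa : Matrix ι ν ℝ} {c Δc : Matrix κ ν ℝ}
    {S : Matrix ν ν ℝ} {L : Matrix ν κ ℝ} {x top : Matrix ν δ ℝ} {y bot : Matrix κ δ ℝ}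
    (hS : S * (aᵀ * a) + L * c = 1) (hSc : S * cᵀ = 0)
    (h : (kktMatrix a c + kktIncrement a Δa Δc) * Matrix.fromRows x y = Matrix.fromRows top bot) :
    x = S * top + L * bot
      - Matrix.fromCols S L * (kktIncrement a Δa Δc * Matrix.fromRows x y) := by
  have h1 : Matrix.fromCols S L * kktMatrix a c
      = Matrix.fromCols (1 : Matrix ν ν ℝ) (0 : Matrix ν κ ℝ) := by
    rw [kktMatrix, Matrix.fromCols_mul_fromBlocks, hS, hSc]
    simp
  have h2 := congrArg (fun z => Matrix.fromCols S L * z) h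
  simp only [Matrix.add_mul, Matrix.mul_add, ← Matrix.mul_assoc, h1] at h2
  rw [Matrix.fromCols_mul_fromRows, Matrix.fromCols_mul_fromRows, Matrix.one_mul,
    Matrix.zero_mul, add_zero] at h2
  rw [← h2, ← Matrix.mul_assoc]
  abel

attribute [local instance] Matrix.frobeniusNormedAddCommGroup

omit [DecidableEq ι] [DecidableEq κ] [DecidableEq ν] in
theorem norm_kktIncrement_le {a Δa : Matrix ι ν ℝ} {c Δc : Matrix κ ν ℝ} {ε : ℝ}
    (hε1 : ε ≤ 1) (ha : ‖Δa‖ ≤ ε * ‖a‖) (hc : ‖Δc‖ ≤ ε * ‖c‖) :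
    ‖kktIncrement a Δa Δc‖ ≤ ε * (3 * ‖a‖ ^ 2 + 2 * ‖c‖) := by
  -- Makes ΔaᵀΔa also O(ε), whence the constant 3.
  have ha1 : ‖Δa‖ ≤ ‖a‖ := ha.trans (mul_le_of_le_one_left (norm_nonneg a) hε1)
  have t1 : ‖Δaᵀ * a‖ ≤ ‖Δa‖ * ‖a‖ := norm_transpose_mul_le _ _
  have t2 : ‖aᵀ * Δa‖ ≤ ‖a‖ * ‖Δa‖ := norm_transpose_mul_le _ _
  have t3 : ‖Δaᵀ * Δa‖ ≤ ‖Δa‖ * ‖Δa‖ := norm_transpose_mul_le _ _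
  have t : ‖Δaᵀ * a + aᵀ * Δa + Δaᵀ * Δa‖ ≤ ‖Δaᵀ * a‖ + ‖aᵀ * Δa‖ + ‖Δaᵀ * Δa‖ := norm_add₃_le
  have s1 := norm_fromCols_le (Δaᵀ * a + aᵀ * Δa + Δaᵀ * Δa) Δcᵀ
  have s2 := norm_fromCols_le Δc (0 : Matrix κ κ ℝ)
  have s3 := norm_fromRows_le (Matrix.fromCols (Δaᵀ * a + aᵀ * Δa + Δaᵀ * Δa) Δcᵀ)
    (Matrix.fromCols Δc (0 : Matrix κ κ ℝ))
  rw [Matrix.fromRows_fromCols_eq_fromBlocks] at s3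
  rw [Matrix.frobenius_norm_transpose] at s1
  rw [norm_zero] at s2
  have e1 := mul_le_mul_of_nonneg_right ha (norm_nonneg a)
  have e2 := mul_le_mul_of_nonneg_left ha1 (norm_nonneg Δa)
  rw [kktIncrement]
  nlinarith

/-- The coefficient of `ε` in the bound for the error of the solution. -/
noncomputable def firstOrderBound (a : Matrix ι ν ℝ) (b : Matrix ι δ ℝ) (c : Matrix κ ν ℝ)
    (d : Matrix κ δ ℝ) (X : Matrix ν δ ℝ) (Q : Matrix ν ι ℝ) (L : Matrix ν κ ℝ) : ℝ :=
  norm2 L * (frobR d + frobR c * frobR X) + norm2 Q * (frobR b + frobR a * frobR X)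
    + norm2 Q ^ 2 * (frobR c * norm2 (a * L) + frobR a) * frobR (b - a * X)

/-- The identity QQᵀaᵀ = Q makes Δb - ΔaX cost only one factor `norm2 Q`; the terms with R and l
cost two. Writing l through the residual produces the factor `norm2 (a * L)`. -/
theorem norm_first_order_le {a Δa : Matrix ι ν ℝ} {b Δb : Matrix ι δ ℝ} {c Δc : Matrix κ ν ℝ}
    {d Δd : Matrix κ δ ℝ} {X : Matrix ν δ ℝ} {l : Matrix κ δ ℝ} {Q : Matrix ν ι ℝ}
    {L : Matrix ν κ ℝ} {ε : ℝ} (hQ : Q * Qᵀ * aᵀ = Q) (hl : l = (a * L)ᵀ * (b - a * X))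
    (hε : 0 ≤ ε) (ha : ‖Δa‖ ≤ ε * ‖a‖) (hb : ‖Δb‖ ≤ ε * ‖b‖) (hc : ‖Δc‖ ≤ ε * ‖c‖)
    (hd : ‖Δd‖ ≤ ε * ‖d‖) :
    ‖Q * Qᵀ * (Δaᵀ * (b - a * X) + aᵀ * (Δb - Δa * X) - Δcᵀ * l + Δaᵀ * (Δb - Δa * X))
        + L * (Δd - Δc * X)‖
      ≤ ε * firstOrderBound a b c d X Q L
        + ε ^ 2 * (norm2 Q ^ 2 * (‖a‖ * (‖b‖ + ‖a‖ * ‖X‖))) := by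
  have hQQ : ∀ N : Matrix ν δ ℝ, ‖Q * Qᵀ * N‖ ≤ norm2 Q ^ 2 * ‖N‖ := by
    intro N
    have h1 := norm_mul_le_norm2_mul Q (Qᵀ * N)
    have h2 := norm_mul_le_norm2_mul Qᵀ N
    rw [norm2_transpose] at h2
    rw [Matrix.mul_assoc, sq, mul_assoc]
    exact h1.trans (mul_le_mul_of_nonneg_left h2 (norm2_nonneg Q))
  set R := b - a * X with hR
  have w1 : ‖Δb - Δa * X‖ ≤ ε * (‖b‖ + ‖a‖ * ‖X‖) := by
    have h1 := norm_sub_le Δb (Δa * X)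
    have h2 := Matrix.frobenius_norm_mul Δa X
    have h3 := mul_le_mul_of_nonneg_right ha (norm_nonneg X)
    linarith
  have w2 : ‖Δd - Δc * X‖ ≤ ε * (‖d‖ + ‖c‖ * ‖X‖) := by
    have h1 := norm_sub_le Δd (Δc * X)
    have h2 := Matrix.frobenius_norm_mul Δc X
    have h3 := mul_le_mul_of_nonneg_right hc (norm_nonneg X)
    linarith
  have hlb : ‖l‖ ≤ norm2 (a * L) * ‖R‖ := by
    have h := norm_mul_le_norm2_mul (a * L)ᵀ R
    rwa [norm2_transpose, ← hl] at h
  have p1 : ‖Q * Qᵀ * (Δaᵀ * R)‖ ≤ norm2 Q ^ 2 * (ε * ‖a‖ * ‖R‖) := by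
    refine (hQQ _).trans (mul_le_mul_of_nonneg_left ?_ (sq_nonneg _))
    refine (Matrix.frobenius_norm_mul _ _).trans ?_
    rw [Matrix.frobenius_norm_transpose]
    exact mul_le_mul_of_nonneg_right ha (norm_nonneg _)
  have p2 : ‖Q * (Δb - Δa * X)‖ ≤ norm2 Q * (ε * (‖b‖ + ‖a‖ * ‖X‖)) := by
    exact (norm_mul_le_norm2_mul _ _).trans (mul_le_mul_of_nonneg_left w1 (norm2_nonneg _))
  have p3 : ‖Q * Qᵀ * (Δcᵀ * l)‖ ≤ norm2 Q ^ 2 * (ε * ‖c‖ * (norm2 (a * L) * ‖R‖)) := by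
    refine (hQQ _).trans (mul_le_mul_of_nonneg_left ?_ (sq_nonneg _))
    refine (Matrix.frobenius_norm_mul _ _).trans ?_
    rw [Matrix.frobenius_norm_transpose]
    exact mul_le_mul hc hlb (norm_nonneg _) (by positivity)
  have p4 : ‖Q * Qᵀ * (Δaᵀ * (Δb - Δa * X))‖
      ≤ norm2 Q ^ 2 * (ε * ‖a‖ * (ε * (‖b‖ + ‖a‖ * ‖X‖))) := by
    refine (hQQ _).trans (mul_le_mul_of_nonneg_left ?_ (sq_nonneg _))
    refine (Matrix.frobenius_norm_mul _ _).trans ?_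
    rw [Matrix.frobenius_norm_transpose]
    exact mul_le_mul ha w1 (norm_nonneg _) (by positivity)
  have p5 : ‖L * (Δd - Δc * X)‖ ≤ norm2 L * (ε * (‖d‖ + ‖c‖ * ‖X‖)) := by
    exact (norm_mul_le_norm2_mul _ _).trans (mul_le_mul_of_nonneg_left w2 (norm2_nonneg _))
  have e : Q * Qᵀ * (Δaᵀ * R + aᵀ * (Δb - Δa * X) - Δcᵀ * l + Δaᵀ * (Δb - Δa * X))
      = Q * Qᵀ * (Δaᵀ * R) + Q * (Δb - Δa * X) - Q * Qᵀ * (Δcᵀ * l)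
        + Q * Qᵀ * (Δaᵀ * (Δb - Δa * X)) := by
    rw [Matrix.mul_add, Matrix.mul_sub, Matrix.mul_add, ← Matrix.mul_assoc _ aᵀ, hQ]
  rw [e]
  have q1 := norm_add_le (Q * Qᵀ * (Δaᵀ * R) + Q * (Δb - Δa * X) - Q * Qᵀ * (Δcᵀ * l)
        + Q * Qᵀ * (Δaᵀ * (Δb - Δa * X))) (L * (Δd - Δc * X))
  have q2 := norm_add_le (Q * Qᵀ * (Δaᵀ * R) + Q * (Δb - Δa * X) - Q * Qᵀ * (Δcᵀ * l))
    (Q * Qᵀ * (Δaᵀ * (Δb - Δa * X)))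
  have q3 := norm_sub_le (Q * Qᵀ * (Δaᵀ * R) + Q * (Δb - Δa * X)) (Q * Qᵀ * (Δcᵀ * l))
  have q4 := norm_add_le (Q * Qᵀ * (Δaᵀ * R)) (Q * (Δb - Δa * X))
  simp only [firstOrderBound, frobR_eq_norm, ← hR]
  linarith

theorem exists_perturbation_bound {a : Matrix ι ν ℝ} {b : Matrix ι δ ℝ} {c : Matrix κ ν ℝ}
    {d : Matrix κ δ ℝ} {X : Matrix ν δ ℝ} {l : Matrix κ δ ℝ} {Q : Matrix ν ι ℝ}
    {L : Matrix ν κ ℝ} (hu : IsUnit (kktMatrix a c))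
    (h1 : aᵀ * a * X + cᵀ * l = aᵀ * b) (h2 : c * X = d)
    (hQ : Q * Qᵀ * aᵀ = Q) (hcQ : c * Q = 0) (hQL : Q * a + L * c = 1) (hcL : c * L = 1) :
    ∃ ε₀ : ℝ, 0 < ε₀ ∧ ∃ K : ℝ, ∀ ε : ℝ, 0 ≤ ε → ε ≤ ε₀ →
      ∀ (Δa : Matrix ι ν ℝ) (Δb : Matrix ι δ ℝ) (Δc : Matrix κ ν ℝ) (Δd : Matrix κ δ ℝ),
      frobR Δa ≤ ε * frobR a → frobR Δb ≤ ε * frobR b →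
      frobR Δc ≤ ε * frobR c → frobR Δd ≤ ε * frobR d →
      (c + Δc).rank = Fintype.card κ ∧
      ∃ X' : Matrix ν δ ℝ,
        (∀ Y, IsLSESolution (a + Δa) (b + Δb) (c + Δc) (d + Δd) Y ↔ Y = X') ∧
        frobR (X' - X) ≤ ε * firstOrderBound a b c d X Q L + K * ε ^ 2 := by
  simp only [frobR_eq_norm]
  obtain ⟨G, hG⟩ : ∃ G, G * kktMatrix a c = 1 := hu.exists_left_inv
  have hl : l = (a * L)ᵀ * (b - a * X) := by
    have h3 : aᵀ * (b - a * X) = cᵀ * l := by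
      rw [Matrix.mul_sub, ← h1, Matrix.mul_assoc]; abel
    rw [Matrix.transpose_mul, Matrix.mul_assoc, h3, ← Matrix.mul_assoc, ← Matrix.transpose_mul,
      hcL, Matrix.transpose_one, Matrix.one_mul]
  have hS : Q * Qᵀ * (aᵀ * a) + L * c = 1 := by rw [← Matrix.mul_assoc, hQ, hQL]
  have hSc : Q * Qᵀ * cᵀ = 0 := by
    rw [Matrix.mul_assoc, ← Matrix.transpose_mul, hcQ, Matrix.transpose_zero, Matrix.mul_zero]
  -- Up to the factor ε, `e` bounds the KKT increment, `w` bounds Δb - ΔaX, and `f` bounds the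
  -- right-hand side of the error equation.
  set e := 3 * ‖a‖ ^ 2 + 2 * ‖c‖ with he
  have he0 : 0 ≤ e := by positivity
  set w := ‖b‖ + ‖a‖ * ‖X‖ with hw
  have hw0 : 0 ≤ w := by positivity
  set f := ‖a‖ * ‖b - a * X‖ + 2 * (‖a‖ * w) + ‖c‖ * ‖l‖ + (‖d‖ + ‖c‖ * ‖X‖) with hf
  have hf0 : 0 ≤ f := by positivity
  have hge : 0 ≤ ‖G‖ * e := by positivity
  -- The second entry of the minimum forces ‖G‖·εe ≤ 1/2, and the +1 keeps its denominator positive.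
  -- In K, the first summand is the explicit quadratic term; the second comes from the increment (≤
  -- εe) acting on the error (≤ 2‖G‖εf).
  refine ⟨min 1 (1 / (2 * (‖G‖ * e) + 1)), by positivity,
    norm2 Q ^ 2 * (‖a‖ * w) + ‖Matrix.fromCols (Q * Qᵀ) L‖ * (e * (2 * ‖G‖ * f)), ?_⟩
  intro ε hε0 hε Δa Δb Δc Δd ha hb hc hd
  have hε1 : ε ≤ 1 := hε.trans (min_le_left _ _)
  have hE := norm_kktIncrement_le hε1 ha hc
  have hGE : ‖G‖ * ‖kktIncrement a Δa Δc‖ ≤ 1 / 2 := by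
    have h3 : ε ≤ 1 / (2 * (‖G‖ * e) + 1) := hε.trans (min_le_right _ _)
    rw [le_div_iff₀ (by positivity)] at h3
    have h4 := mul_le_mul_of_nonneg_left hE (norm_nonneg G)
    nlinarith
  have hu' : IsUnit (kktMatrix (a + Δa) (c + Δc)) := by
    rw [kktMatrix_add]
    exact isUnit_add_of_norm_le hG hGE
  obtain ⟨X', l', h1', h2'⟩ := exists_kkt_of_isUnit hu' (b + Δb) (d + Δd)
  refine ⟨rank_eq_card_of_isUnit_kktMatrix hu', X', isLSESolution_iff_eq_of_kkt hu' h1' h2', ?_⟩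
  have hsys := kktMatrix_add_mul_sub h1 h2 h1' h2'
  have hX := sub_eq_first_order_sub hS hSc hsys
  have hz := norm_le_two_mul_of_perturbed_system hG hGE (Matrix.fromRows (X' - X) (l' - l))
  have hfirst := norm_first_order_le (L := L) (Δd := Δd) hQ hl hε0 ha hb hc hd
  have w1 : ‖Δb - Δa * X‖ ≤ ε * w := by
    have h1 := norm_sub_le Δb (Δa * X)
    have h2 := Matrix.frobenius_norm_mul Δa X
    have h3 := mul_le_mul_of_nonneg_right ha (norm_nonneg X)
    rw [hw]
    linarith
  have hF : ‖Matrix.fromRows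
        (Δaᵀ * (b - a * X) + aᵀ * (Δb - Δa * X) - Δcᵀ * l + Δaᵀ * (Δb - Δa * X))
        (Δd - Δc * X)‖ ≤ ε * f := by
    refine (norm_fromRows_le _ _).trans ?_
    have q1 := norm_add_le (Δaᵀ * (b - a * X) + aᵀ * (Δb - Δa * X) - Δcᵀ * l)
      (Δaᵀ * (Δb - Δa * X))
    have q2 := norm_sub_le (Δaᵀ * (b - a * X) + aᵀ * (Δb - Δa * X)) (Δcᵀ * l)
    have q3 := norm_add_le (Δaᵀ * (b - a * X)) (aᵀ * (Δb - Δa * X))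
    have q4 := norm_sub_le Δd (Δc * X)
    have r1 := (norm_transpose_mul_le Δa (b - a * X)).trans (mul_le_mul_of_nonneg_right ha (norm_nonneg _))
    have r2 := (norm_transpose_mul_le a (Δb - Δa * X)).trans (mul_le_mul_of_nonneg_left w1 (norm_nonneg _))
    have r3 := (norm_transpose_mul_le Δc l).trans (mul_le_mul_of_nonneg_right hc (norm_nonneg _))
    have ha1 : ‖Δa‖ ≤ ‖a‖ := ha.trans (mul_le_of_le_one_left (norm_nonneg a) hε1)
    have r4 := (norm_transpose_mul_le Δa (Δb - Δa * X)).trans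
      (mul_le_mul ha1 w1 (norm_nonneg _) (norm_nonneg _))
    have r5 := (Matrix.frobenius_norm_mul Δc X).trans
      (mul_le_mul_of_nonneg_right hc (norm_nonneg _))
    rw [hf]
    linarith
  rw [hsys] at hz
  have hz' := hz.trans (mul_le_mul_of_nonneg_left hF (by positivity))
  have hrem : ‖Matrix.fromCols (Q * Qᵀ) L
      * (kktIncrement a Δa Δc * Matrix.fromRows (X' - X) (l' - l))‖
      ≤ ‖Matrix.fromCols (Q * Qᵀ) L‖ * ((ε * e) * (2 * ‖G‖ * (ε * f))) := by
    refine (Matrix.frobenius_norm_mul _ _).trans (mul_le_mul_of_nonneg_left ?_ (norm_nonneg _))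
    exact (Matrix.frobenius_norm_mul _ _).trans
      (mul_le_mul hE hz' (norm_nonneg _) (by positivity))
  rw [hX]
  refine (norm_sub_le _ _).trans ?_
  linarith

end Perturbation

/-! ### From reduced biquaternions to real matrices. -/

section Reduction

variable {ι κ μ : Type*} [Fintype ι] [Fintype κ] [Fintype μ]

theorem frobQ_eq_frobR_realCol (M : Matrix ι κ RBQ) : frobQ M = frobR (realCol M) := by
  have h : ∀ q : RBQ, q.abs ^ 2 = q.re ^ 2 + q.imI ^ 2 + q.imJ ^ 2 + q.imK ^ 2 :=
    fun q => Real.sq_sqrt (by positivity)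
  simp only [frobQ, frobR, h, realCol, Fintype.sum_sum_type, Matrix.fromRows_apply_inl,
    Matrix.fromRows_apply_inr, Matrix.map_apply, Finset.sum_add_distrib]
  congr 1
  ring

omit [Fintype ι] [Fintype κ] in
theorem realCol_injective : Function.Injective (realCol : Matrix ι κ RBQ → _) := by
  intro M N h
  simp only [realCol, Matrix.fromRows_inj.eq_iff] at h
  obtain ⟨⟨h0, h1⟩, h2, h3⟩ := h
  ext i j
  · exact congrFun (congrFun h0 i) j
  · exact congrFun (congrFun h1 i) j
  · exact congrFun (congrFun h2 i) j
  · exact congrFun (congrFun h3 i) j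

omit [Fintype ι] [Fintype κ] in
theorem realCol_add (M N : Matrix ι κ RBQ) : realCol (M + N) = realCol M + realCol N := by
  ext ((i | i) | (i | i)) j <;> simp [realCol]

omit [Fintype ι] [Fintype κ] in
theorem realCol_sub (M N : Matrix ι κ RBQ) : realCol (M - N) = realCol M - realCol N := by
  ext ((i | i) | (i | i)) j <;> simp [realCol]

omit [Fintype ι] [Fintype μ] in
theorem realCol_mul_toRBQ (M : Matrix ι κ RBQ) (X : Matrix κ μ ℝ) :
    realCol (M * toRBQ X) = realCol M * X := by
  let fre : RBQ →+ ℝ := ⟨⟨RBQ.re, rfl⟩, fun _ _ => rfl⟩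
  let fI : RBQ →+ ℝ := ⟨⟨RBQ.imI, rfl⟩, fun _ _ => rfl⟩
  let fJ : RBQ →+ ℝ := ⟨⟨RBQ.imJ, rfl⟩, fun _ _ => rfl⟩
  let fK : RBQ →+ ℝ := ⟨⟨RBQ.imK, rfl⟩, fun _ _ => rfl⟩
  ext ((i | i) | (i | i)) j
  · refine (map_sum fre (fun k => M i k * toRBQ X k j) Finset.univ).trans ?_
    exact Finset.sum_congr rfl fun k _ => by simp [fre, realCol, toRBQ, RBQ.ofReal]
  · refine (map_sum fI (fun k => M i k * toRBQ X k j) Finset.univ).trans ?_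
    exact Finset.sum_congr rfl fun k _ => by simp [fI, realCol, toRBQ, RBQ.ofReal]
  · refine (map_sum fJ (fun k => M i k * toRBQ X k j) Finset.univ).trans ?_
    exact Finset.sum_congr rfl fun k _ => by simp [fJ, realCol, toRBQ, RBQ.ofReal]
  · refine (map_sum fK (fun k => M i k * toRBQ X k j) Finset.univ).trans ?_
    exact Finset.sum_congr rfl fun k _ => by simp [fK, realCol, toRBQ, RBQ.ofReal]

theorem isRealSolution_iff {m n d p : ℕ} {A : Matrix (Fin m) (Fin n) RBQ}
    {B : Matrix (Fin m) (Fin d) RBQ} {C : Matrix (Fin p) (Fin n) RBQ}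
    {D : Matrix (Fin p) (Fin d) RBQ} {X : Matrix (Fin n) (Fin d) ℝ} :
    IsRealSolution A B C D X ↔
      IsLSESolution (realCol A) (realCol B) (realCol C) (realCol D) X := by
  simp only [IsRealSolution, IsLSESolution, frobQ_eq_frobR_realCol, realCol_sub,
    realCol_mul_toRBQ, ← realCol_injective.eq_iff]

theorem pinv_zero : pinv (0 : Matrix ι κ ℝ) = 0 := by
  have h := (pinv_spec (0 : Matrix ι κ ℝ)).self_mul_mul
  simpa using h.symm

theorem norm2_zero [DecidableEq κ] : norm2 (0 : Matrix ι κ ℝ) = 0 := by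
  simp [norm2]

attribute [local instance] Matrix.frobeniusNormedAddCommGroup in
theorem frobR_eq_zero_iff {M : Matrix ι κ ℝ} : frobR M = 0 ↔ M = 0 := by
  rw [frobR_eq_norm, norm_eq_zero]

end Reduction

theorem firstOrderBound_div_eq {m n d p : ℕ} (A : Matrix (Fin m) (Fin n) RBQ)
    (B : Matrix (Fin m) (Fin d) RBQ) (C : Matrix (Fin p) (Fin n) RBQ)
    (D : Matrix (Fin p) (Fin d) RBQ)
    {X : Matrix (Fin n) (Fin d) ℝ} (hX : X ≠ 0) :
    firstOrderBound (realCol A) (realCol B) (realCol C) (realCol D) X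
        (pinv (realCol A * Pr C)) (Lr A C) / frobR X =
      condA A C * (frobR (realCol D) / (frobR (realCol C) * frobR X) + 1)
        + condB A C * (frobR (realCol B) / (frobR (realCol A) * frobR X) + 1)
        + condB A C ^ 2
          * (frobR (realCol C) / frobR (realCol A) * norm2 (realCol A * Lr A C) + 1)
          * (frobR (resid A B X) / (frobR (realCol A) * frobR X)) := by
  have hx : frobR X ≠ 0 := fun h => hX (frobR_eq_zero_iff.1 h)
  -- When a denominator ‖C‖ or ‖A‖ vanishes, so does the pseudoinverse it multiplies, so the
  -- convention x / 0 = 0 agrees with the undivided bound.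
  have hc : frobR (realCol C) = 0 → norm2 (Lr A C) = 0 := by
    intro h
    rw [frobR_eq_zero_iff] at h
    rw [Lr, h, pinv_zero, Matrix.mul_zero, norm2_zero]
  have ha : frobR (realCol A) = 0 → norm2 (pinv (realCol A * Pr C)) = 0 := by
    intro h
    rw [frobR_eq_zero_iff] at h
    rw [h, Matrix.zero_mul, pinv_zero, norm2_zero]
  simp only [firstOrderBound, condA, condB, resid]
  by_cases h1 : frobR (realCol C) = 0 <;> by_cases h2 : frobR (realCol A) = 0
  · simp [h1, h2, hc h1, ha h2]
  · simp only [h1, hc h1]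
    field_simp
    ring
  · simp only [h2, ha h2]
    field_simp
    ring
  · field_simp

end RBLSE

open RBLSE in
theorem theorem4p8 {m n d p : ℕ} (hmnd : n + d ≤ m)
    (A : Matrix (Fin m) (Fin n) RBQ) (B : Matrix (Fin m) (Fin d) RBQ)
    (C : Matrix (Fin p) (Fin n) RBQ) (D : Matrix (Fin p) (Fin d) RBQ)
    (hC : (realCol C).rank = 4 * p)
    (X : Matrix (Fin n) (Fin d) ℝ)
    (hX : IsRealSolution A B C D X)
    (hX_unique : ∀ Y : Matrix (Fin n) (Fin d) ℝ, IsRealSolution A B C D Y → Y = X)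
    (hX_ne : X ≠ 0) :
    ∃ ε₀ : ℝ, 0 < ε₀ ∧ ∃ K : ℝ, ∀ ε : ℝ, 0 ≤ ε → ε ≤ ε₀ →
      ∀ (ΔA : Matrix (Fin m) (Fin n) RBQ) (ΔB : Matrix (Fin m) (Fin d) RBQ)
        (ΔC : Matrix (Fin p) (Fin n) RBQ) (ΔD : Matrix (Fin p) (Fin d) RBQ),
      frobQ ΔA ≤ ε * frobQ A → frobQ ΔB ≤ ε * frobQ B →
      frobQ ΔC ≤ ε * frobQ C → frobQ ΔD ≤ ε * frobQ D →
      (realCol (C + ΔC)).rank = 4 * p ∧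
      (∃! Xhat : Matrix (Fin n) (Fin d) ℝ,
        IsRealSolution (A + ΔA) (B + ΔB) (C + ΔC) (D + ΔD) Xhat) ∧
      ∀ Xhat : Matrix (Fin n) (Fin d) ℝ,
        IsRealSolution (A + ΔA) (B + ΔB) (C + ΔC) (D + ΔD) Xhat →
        frobR (Xhat - X) / frobR X ≤
          ε * (condA A C * (frobR (realCol D) / (frobR (realCol C) * frobR X) + 1)
            + condB A C * (frobR (realCol B) / (frobR (realCol A) * frobR X) + 1)
            + condB A C ^ 2
              * (frobR (realCol C) / frobR (realCol A) * norm2 (realCol A * Lr A C) + 1)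
              * (frobR (resid A B X) / (frobR (realCol A) * frobR X)))
          + K * ε ^ 2 := by
  have hcard : Fintype.card ((Fin p ⊕ Fin p) ⊕ (Fin p ⊕ Fin p)) = 4 * p := by
    simp only [Fintype.card_sum, Fintype.card_fin]
    ring
  have hrank := hC.trans hcard.symm
  -- A nonzero X has at least one column, as the uniqueness argument for the KKT matrix requires.
  have hd : Nonempty (Fin d) := by
    by_contra h
    rw [not_nonempty_iff] at h
    exact hX_ne (Subsingleton.elim _ _)
  simp only [isRealSolution_iff, realCol_add, frobQ_eq_frobR_realCol] at hX hX_unique ⊢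
  have hu := isUnit_kktMatrix_of_unique hrank hX hX_unique
  obtain ⟨X₀, l, h1, h2⟩ := exists_kkt_of_isUnit hu (realCol B) (realCol D)
  obtain rfl : X = X₀ := (isLSESolution_iff_eq_of_kkt hu h1 h2 X).1 hX
  obtain ⟨ε₀, hε₀, K, hK⟩ := exists_perturbation_bound (Q := pinv (realCol A * Pr C))
    (L := Lr A C) hu h1 h2 (pinv_mul_transpose_mul_transpose _ _) (mul_pinv_mul_projection _ _)
    (pinv_mul_add_constrained_inverse_mul hu) (mul_constrained_inverse _ _ hrank)
  refine ⟨ε₀, hε₀, K / frobR X, fun ε h0 hε ΔA ΔB ΔC ΔD hA hB hC' hD => ?_⟩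
  obtain ⟨hr, X', hX', hbound⟩ := hK ε h0 hε _ _ _ _ hA hB hC' hD
  refine ⟨hr.trans hcard, ⟨X', (hX' X').2 rfl, fun Y hY => (hX' Y).1 hY⟩, fun Xhat hXhat => ?_⟩
  rw [(hX' Xhat).1 hXhat, ← firstOrderBound_div_eq A B C D hX_ne]
  have h := div_le_div_of_nonneg_right hbound (frobR_nonneg X)
  rw [add_div, mul_div_assoc, mul_div_right_comm] at h
  exact h
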